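/- Let $V$ be a finite-dimensional real vector space, let $\mathcal A$ be a finite set of affine hyperplanes in $V$, and let $m\ge 1$. For each $H\in\mathcal A$, with equation $\alpha(x)=c$, where $\alpha\in V^*\setminus\{0\}$ and $c\in\mathbb R$, put $v_H=(\alpha,-c)\in V^*\times\mathbb R$ (well defined up to a nonzero scalar). Let $M_{\mathcal A}$ be the matroid on $\mathcal A$ in which a set of hyperplanes is independent if and only if the corresponding vectors $v_H$ are linearly independent. Let $D_m M_{\mathcal A}$ be its $m$-th Dilworth truncation, i.e. the matroid on the set $\binom{\mathcal A}{m+1}$ of $(m+1)$-element subsets of $\mathcal A$ whose independent sets are the $I\subseteq\binom{\mathcal A}{m+1}$ with $$\operatorname{rank}_{M_{\mathcal A}}\Bigl(\bigcup_{S\in I'}S\Bigr)\ \ge\ \#I'+m\qquad\text{for all } \emptyset\ne I'\subseteq I .$$ For points $p_1,\dots,p_m\in V$, let the generalized valid order arrangement $\mathrm{vo}(\mathcal A;p_1,\dots,p_m)$ be the set of all affine hyperplanes $K$ of $V$ that contain $p_1,\dots,p_m$ and pass through the intersection of some $m+1$ distinct hyperplanes $H_0,\dots,H_m$ of $\mathcal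 A$, including the intersection at infinity. The last condition means that $\bigcap_i\widehat H_i\subseteq\widehat K$, where for a hyperplane $H=\{x:\alpha(x)=c\}$ we write $\widehat H=\{(x,y)\in V\times\mathbb R:\alpha(x)=cy\}$ (the projective closure of $H$ in homogeneous coordinates). **Theorem.** If $p_1,\dots,p_m$ are sufficiently generic, then the intersection lattice of $\mathrm{vo}(\mathcal A;p_1,\dots,p_m)$ (all nonempty intersections of its hyperplanes, including $V$ as the empty intersection, ordered by reverse inclusion) is isomorphic, as a partially ordered set, to the lattice of flats of $D_mM_{\mathcal A}$ (ordered by inclusion). Here "sufficiently generic" means: there is a nonzero real polynomial $P$ in the coordinates of $m$ points of $V$, depending only on $\mathcal A$ and $m$, such that the statement holds for all $(p_1,\dots,p_m)\in V^m$ with $P(p_1,\dots,p_m)\neq 0$. -/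

import Mathlib

noncomputable section

namespace ValidOrder

/-! ### Linear matroids -/

/-- The linear matroid on a ground set `E` represented by a family of vectors `v`: a subset `I` of
`E` is independent if the vectors `v e`, `e ∈ I`, are linearly independent. -/
def linearMatroid {K W ι : Type*} [Field K] [AddCommGroup W] [Module K W]
    (v : ι → W) (E : Set ι) : Matroid ι :=
  (IndepMatroid.ofFinitaryCardAugment E (fun I => I ⊆ E ∧ LinearIndepOn K v I)
    ⟨Set.empty_subset _, linearIndepOn_empty K v⟩
    (fun _ _ hJ h => ⟨h.trans hJ.1, hJ.2.mono h⟩)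
    (by
      intro I J hI hIf hJ hJf hlt
      by_contra! hcon
      have hspan : ∀ e ∈ J, v e ∈ Submodule.span K (v '' I) := by
        intro e he
        by_contra hv
        have heI : e ∉ I := fun h => hv (Submodule.subset_span ⟨e, h, rfl⟩)
        exact hcon e he heI (Set.insert_subset (hJ.1 he) hI.1) (hI.2.insert hv)
      have hle : Submodule.span K (v '' J) ≤ Submodule.span K (v '' I) := by
        rw [Submodule.span_le]
        rintro _ ⟨e, he, rfl⟩
        exact hspan e he
      have hrank : ∀ S : Set ι, S.Finite → LinearIndepOn K v S →
          Module.finrank K (Submodule.span K (v '' S)) = S.ncard := by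
        intro S hS h
        let _ := hS.fintype
        have h1 := finrank_span_eq_card h
        rw [Set.ncard_eq_toFinset_card', Set.toFinset_card, ← h1, Set.image_eq_range]
      have : Module.Finite K (Submodule.span K (v '' I)) :=
        FiniteDimensional.span_of_finite K (hIf.image v)
      have := Submodule.finrank_mono hle
      rw [hrank I hIf hI.2, hrank J hJf hJ.2] at this
      omega)
    (by
      intro I h
      refine ⟨fun e he => (h {e} (by simpa using he) (Set.finite_singleton e)).1 rfl, ?_⟩
      rw [linearIndepOn_iff_linearIndepOn_finset]
      intro s hs
      exact (h s hs s.finite_toSet).2)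
    (fun _ h => h.1)).matroid

/-! ### Dilworth truncations -/

/-- Matroid augmentation for the independent sets defined by `f T - k`, where `f` is monotone and
submodular. -/
theorem exists_augment {β : Type*} [DecidableEq β] (f : Finset β → ℕ) (k : ℕ)
    (mono : ∀ S T, S ⊆ T → f S ≤ f T)
    (submod : ∀ S T, f (S ∩ T) + f (S ∪ T) ≤ f S + f T) (I J : Finset β)
    (hI : ∀ T ⊆ I, T.Nonempty → T.card + k ≤ f T)
    (hJ : ∀ T ⊆ J, T.Nonempty → T.card + k ≤ f T) (hlt : I.card < J.card) :
    ∃ e ∈ J, e ∉ I ∧ ∀ T ⊆ insert e I, T.Nonempty → T.card + k ≤ f T := by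
  classical
  by_contra! hcon
  let tight : Finset β → Prop := fun S => S ⊆ I ∧ S.Nonempty ∧ f S = S.card + k
  have hunion : ∀ S T, tight S → tight T → (S ∩ T).Nonempty → tight (S ∪ T) := by
    rintro S T ⟨hS, hS', hSf⟩ ⟨hT, hT', hTf⟩ hne
    refine ⟨Finset.union_subset hS hT, hS'.mono Finset.subset_union_left, ?_⟩
    have h1 := hI (S ∩ T) (Finset.inter_subset_left.trans hS) hne
    have h2 := hI (S ∪ T) (Finset.union_subset hS hT) (hS'.mono Finset.subset_union_left)
    have h3 := submod S T
    have h4 := Finset.card_inter_add_card_union S T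
    omega
  -- adding to a larger set an element that does not increase `f` on a smaller one
  have hext : ∀ S T e, S ⊆ T → f (insert e S) = f S → f (insert e T) = f T := by
    intro S T e hST he
    have h1 := submod (insert e S) T
    have h2 := mono S (insert e S ∩ T)
      (Finset.subset_inter (Finset.subset_insert _ _) hST)
    have h3 : insert e S ∪ T = insert e T := by
      rw [Finset.insert_union, Finset.union_eq_right.2 hST]
    rw [h3] at h1
    have h4 := mono T (insert e T) (Finset.subset_insert _ _)
    omega
  let 𝓜 := I.powerset.filter (fun S => Maximal tight S)
  have hmem : ∀ S, S ∈ 𝓜 ↔ Maximal tight S := by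
    intro S
    simp only [𝓜, Finset.mem_filter, Finset.mem_powerset, and_iff_right_iff_imp]
    exact fun h => h.prop.1
  have hmax : ∀ S, tight S → ∃ S' ∈ 𝓜, S ⊆ S' := by
    intro S hS
    have hfin : {T | tight T}.Finite :=
      I.powerset.finite_toSet.subset (fun T hT => by simpa using hT.1)
    obtain ⟨S', hSS', hS'⟩ := hfin.exists_le_maximal hS
    exact ⟨S', (hmem _).2 hS', hSS'⟩
  have hdisj : ∀ S ∈ 𝓜, ∀ T ∈ 𝓜, S ≠ T → Disjoint S T := by
    intro S hS T hT hne
    rw [hmem] at hS hT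
    by_contra hd
    have hu := hunion S T hS.prop hT.prop (Finset.not_disjoint_iff_nonempty_inter.1 hd)
    exact hne ((hS.eq_of_le hu Finset.subset_union_left).trans
      (hT.eq_of_le hu Finset.subset_union_right).symm)
  let C : Finset β → Finset β := fun S => J.filter (fun e => f (insert e S) = f S)
  have hC : ∀ S ∈ 𝓜, (C S).card ≤ S.card := by
    intro S hS
    rw [hmem] at hS
    have hgen : ∀ D : Finset β, D ⊆ C S → f (S ∪ D) = f S := by
      intro D
      induction D using Finset.induction_on with
      | empty => simp
      | insert e D _ ih =>
        intro hD
        have h1 := ih ((Finset.subset_insert _ _).trans hD)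
        have h2 := (Finset.mem_filter.1 (hD (Finset.mem_insert_self e D))).2
        rw [Finset.union_insert, hext S (S ∪ D) e Finset.subset_union_left h2, h1]
    rcases (C S).eq_empty_or_nonempty with h | h
    · simp [h]
    · have h1 := hJ (C S) (Finset.filter_subset _ _) h
      have h2 := mono (C S) (S ∪ C S) Finset.subset_union_right
      have h3 := hgen (C S) subset_rfl
      have h4 := hS.prop.2.2
      omega
  have hcover : J ⊆ 𝓜.biUnion C ∪ (I \ 𝓜.biUnion id) := by
    intro e he
    by_cases heI : e ∈ I
    · by_cases h : ∃ S ∈ 𝓜, e ∈ S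
      · obtain ⟨S, hS, heS⟩ := h
        refine Finset.mem_union_left _ (Finset.mem_biUnion.2 ⟨S, hS, ?_⟩)
        exact Finset.mem_filter.2 ⟨he, by rw [Finset.insert_eq_of_mem heS]⟩
      · refine Finset.mem_union_right _ (Finset.mem_sdiff.2 ⟨heI, ?_⟩)
        simpa using h
    · obtain ⟨T, hT, hTne, hTf⟩ := hcon e he heI
      have heT : e ∈ T := by
        by_contra h
        have := hI T ((Finset.subset_insert_iff_of_notMem h).1 hT) hTne
        omega
      have hSI : T.erase e ⊆ I := Finset.subset_insert_iff.1 hT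
      have hins : insert e (T.erase e) = T := Finset.insert_erase heT
      have hcard := Finset.card_erase_add_one heT
      have hSne : (T.erase e).Nonempty := by
        by_contra h
        rw [Finset.not_nonempty_iff_eq_empty] at h
        have := hJ T (by rw [← hins, h]; simpa using he) hTne
        omega
      have h1 := hI _ hSI hSne
      have h2 := mono (T.erase e) T (Finset.erase_subset _ _)
      obtain ⟨S', hS', hSS'⟩ := hmax (T.erase e) ⟨hSI, hSne, by omega⟩
      refine Finset.mem_union_left _ (Finset.mem_biUnion.2 ⟨S', hS', ?_⟩)
      exact Finset.mem_filter.2 ⟨he, hext _ S' e hSS' (by rw [hins]; omega)⟩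
  have h1 := Finset.card_le_card hcover
  have h2 := Finset.card_union_le (𝓜.biUnion C) (I \ 𝓜.biUnion id)
  have h3 : (𝓜.biUnion C).card ≤ ∑ S ∈ 𝓜, S.card :=
    Finset.card_biUnion_le.trans (Finset.sum_le_sum hC)
  have h4 : (𝓜.biUnion id).card = ∑ S ∈ 𝓜, S.card :=
    Finset.card_biUnion (fun S hS T hT hne => hdisj S hS T hT hne)
  have h5 : 𝓜.biUnion id ⊆ I := by
    intro x hx
    obtain ⟨S, hS, hxS⟩ := Finset.mem_biUnion.1 hx
    exact ((hmem S).1 hS).prop.1 hxS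
  have h6 := Finset.card_sdiff_add_card_eq_card h5
  omega

/-- The family `I` of sets satisfies `rank_M (⋃ I') ≥ #I' + k` for all finite nonempty
`I' ⊆ I`. -/
def DilworthCondition {α : Type*} (M : Matroid α) (k : ℕ) (I : Set (Finset α)) : Prop :=
  ∀ I' : Finset (Finset α), (I' : Set (Finset α)) ⊆ I → I'.Nonempty →
    ((I'.card + k : ℕ) : ℕ∞) ≤ M.eRk (⋃ s ∈ I', (s : Set α))

open Classical in
theorem DilworthCondition.augment {α : Type*} (M : Matroid α) (k : ℕ) (I J : Finset (Finset α))
    (hI : DilworthCondition M k I) (hJ : DilworthCondition M k J) (hlt : I.card < J.card) :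
    ∃ e ∈ J, e ∉ I ∧ DilworthCondition M k (insert e (I : Set (Finset α))) := by
  let U : Finset (Finset α) → Set α := fun T => ⋃ s ∈ T, (s : Set α)
  have hU : ∀ T, (((M.eRk (U T)).toNat : ℕ) : ℕ∞) = M.eRk (U T) := by
    intro T
    apply ENat.natCast_toNat
    rw [Matroid.eRk_ne_top_iff]
    exact M.isRkFinite_of_finite (T.finite_toSet.biUnion (fun s _ => s.finite_toSet))
  have key : ∀ T (n : ℕ), (n : ℕ∞) ≤ M.eRk (U T) ↔ n ≤ (M.eRk (U T)).toNat := by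
    intro T n
    rw [← hU T, ENat.toNat_natCast, Nat.cast_le]
  have hmono : ∀ S T, S ⊆ T → (M.eRk (U S)).toNat ≤ (M.eRk (U T)).toNat := by
    intro S T h
    rw [← key, hU]
    exact M.eRk_mono (Set.biUnion_subset_biUnion_left h)
  obtain ⟨e, heJ, heI, h⟩ := exists_augment (fun T => (M.eRk (U T)).toNat) k hmono
    (by
      intro S T
      have h1 := M.eRk_inter_add_eRk_union_le (U S) (U T)
      have h2 : U (S ∪ T) = U S ∪ U T := Finset.set_biUnion_union S T _
      have h3 : M.eRk (U (S ∩ T)) ≤ M.eRk (U S ∩ U T) := M.eRk_mono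
        (Set.subset_inter (Set.biUnion_subset_biUnion_left Finset.inter_subset_left)
          (Set.biUnion_subset_biUnion_left Finset.inter_subset_right))
      rw [← h2] at h1
      have h4 := (add_le_add_left h3 (M.eRk (U (S ∪ T)))).trans h1
      rw [← hU (S ∩ T), ← hU (S ∪ T), ← hU S, ← hU T] at h4
      exact_mod_cast h4)
    I J
    (fun T hT hne => (key T _).1 (hI T (by exact_mod_cast hT) hne))
    (fun T hT hne => (key T _).1 (hJ T (by exact_mod_cast hT) hne)) hlt
  exact ⟨e, heJ, heI, fun T hT hne => (key T _).2 (h T (by exact_mod_cast hT) hne)⟩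

/-- The `k`-th Dilworth truncation `D_k M` of a matroid `M`: its ground set consists of the
`(k + 1)`-element subsets of the ground set of `M`, and a set `I` of these is independent if
`rank_M (⋃ I') ≥ #I' + k` for all (finite) nonempty `I' ⊆ I`. -/
def dilworthTruncation {α : Type*} (k : ℕ) (M : Matroid α) : Matroid (Finset α) :=
  (IndepMatroid.ofFinitaryCardAugment {s : Finset α | (s : Set α) ⊆ M.E ∧ s.card = k + 1}
    (fun I => I ⊆ {s : Finset α | (s : Set α) ⊆ M.E ∧ s.card = k + 1} ∧ DilworthCondition M k I)
    ⟨Set.empty_subset _, fun I' h hne => by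
      obtain ⟨x, hx⟩ := hne
      exact absurd (h hx) (Set.notMem_empty x)⟩
    (fun _ _ hJ h => ⟨h.trans hJ.1, fun I' hI' => hJ.2 I' (hI'.trans h)⟩)
    (by
      intro I J hI hIf hJ hJf hlt
      lift I to Finset (Finset α) using hIf
      lift J to Finset (Finset α) using hJf
      rw [Set.ncard_coe_finset, Set.ncard_coe_finset] at hlt
      obtain ⟨e, heJ, heI, h⟩ := DilworthCondition.augment M k I J hI.2 hJ.2 hlt
      exact ⟨e, heJ, by simpa using heI, Set.insert_subset (hJ.1 heJ) hI.1, h⟩)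
    (by
      intro I h
      exact ⟨fun s hs => (h {s} (by simpa using hs) (Set.finite_singleton s)).1 rfl,
        fun I' hI' hne => (h I' hI' I'.finite_toSet).2 I' subset_rfl hne⟩)
    (fun _ h => h.1)).matroid

/-- The lattice of flats `L_M` of a matroid, ordered by inclusion. -/
abbrev LatticeOfFlats {α : Type*} (M : Matroid α) : Type _ := {F : Set α // M.IsFlat F}

/-! ### Hyperplane arrangements -/

variable {V : Type*} [AddCommGroup V] [Module ℝ V]

/-- `H` is defined by the equation `α x = c`, with `α ≠ 0`. -/
def HasEquation (H : AffineSubspace ℝ V) (α : Module.Dual ℝ V) (c : ℝ) : Prop :=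
  α ≠ 0 ∧ ∀ x, x ∈ H ↔ α x = c

/-- An affine hyperplane of `V`. -/
def IsHyperplane (H : AffineSubspace ℝ V) : Prop :=
  ∃ (α : Module.Dual ℝ V) (c : ℝ), HasEquation H α c

open Classical in
/-- The vector `v_H = (α, -c)` associated with a hyperplane `H` that has the equation `α x = c`.
It is well defined up to a nonzero scalar, and one choice is made here (the value is `0` if `H` is
not a hyperplane). -/
def normalVec (H : AffineSubspace ℝ V) : Module.Dual ℝ V × ℝ :=
  if h : IsHyperplane H then (h.choose, -h.choose_spec.choose) else 0

/-- The matroid `M_A` of an arrangement `A`: the linear matroid of the vectors `v_H`, `H ∈ A`. -/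
def arrangementMatroid (A : Finset (AffineSubspace ℝ V)) : Matroid (AffineSubspace ℝ V) :=
  linearMatroid (K := ℝ) normalVec (A : Set (AffineSubspace ℝ V))

/-- The semicone over `H`: if `H` is the hyperplane `α x = c`, then this is the linear hyperplane
`α x = c y` in the space `V × ℝ` of pairs `(x, y)`. Its points with `y = 1` are those of `H`, and
its points with `y = 0` form the direction of `H`, so that the lines in it are the points of the
projective closure of `H`, including those at infinity. -/
def semicone (H : AffineSubspace ℝ V) : Submodule ℝ (V × ℝ) :=
  LinearMap.ker ((normalVec H).1.coprod ((normalVec H).2 • LinearMap.id))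

theorem hasEquation_normalVec {H : AffineSubspace ℝ V} (h : IsHyperplane H) :
    HasEquation H (normalVec H).1 (-(normalVec H).2) := by
  simp only [normalVec, dif_pos h, neg_neg]
  exact h.choose_spec.choose_spec

/-- The semicone depends only on the hyperplane, not on the chosen equation. -/
theorem mem_semicone_iff {H : AffineSubspace ℝ V} {α : Module.Dual ℝ V} {c : ℝ}
    (h : HasEquation H α c) (x : V) (y : ℝ) : (x, y) ∈ semicone H ↔ α x = c * y := by
  obtain ⟨hα', hH'⟩ := hasEquation_normalVec ⟨α, c, h⟩
  obtain ⟨hα, hH⟩ := h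
  set β := (normalVec H).1
  set e := (normalVec H).2
  have hmem : (x, y) ∈ semicone H ↔ β x + e * y = 0 := by
    simp [semicone, β, e]
  rw [hmem]
  have heq : ∀ z, α z = c ↔ β z = -e := fun z => (hH z).symm.trans (hH' z)
  obtain ⟨u, hu⟩ : ∃ u, α u ≠ 0 := by
    by_contra! h0
    exact hα (LinearMap.ext h0)
  obtain ⟨w, hw⟩ : ∃ w, α w = c := ⟨(c / α u) • u, by simp [hu]⟩
  have hw' : β w = -e := (heq w).1 hw
  have hdir : ∀ z, α z = 0 ↔ β z = 0 := by
    intro z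
    have := heq (w + z)
    rw [map_add, map_add, hw, hw'] at this
    simpa using this
  have := hdir (x - y • w)
  rw [map_sub, map_sub, map_smul, map_smul, hw, hw', smul_eq_mul, smul_eq_mul] at this
  constructor
  · intro h
    have := this.2 (by linarith)
    linarith
  · intro h
    have := this.1 (by linarith)
    linarith

/-- The hyperplane `K` passes through the intersection of the hyperplanes in `S`, including the
intersection at infinity: in the projective closure of `V`, the intersection of (the closures of)
the hyperplanes in `S` is contained in `K`. -/
def PassesThroughInter (K : AffineSubspace ℝ V) (S : Finset (AffineSubspace ℝ V)) : Prop :=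
  ⨅ H ∈ S, semicone H ≤ semicone K

/-- The generalized valid order arrangement `vo(A; p₁, …, p_m)`: all hyperplanes that pass through
`p₁, …, p_m` and through an intersection of `m + 1` hyperplanes of `A`, including intersections at
infinity. -/
def vo (A : Finset (AffineSubspace ℝ V)) {m : ℕ} (p : Fin m → V) : Set (AffineSubspace ℝ V) :=
  {K | IsHyperplane K ∧ (∀ i, p i ∈ K) ∧
    ∃ S ⊆ A, S.card = m + 1 ∧ PassesThroughInter K S}

/-- The intersection lattice of an arrangement: all nonempty intersections of subfamilies,
including the whole space as the empty intersection, ordered by reverse inclusion. -/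
abbrev IntersectionLattice (B : Set (AffineSubspace ℝ V)) : Type _ :=
  {X : AffineSubspace ℝ V // X ≠ ⊥ ∧ ∃ C ⊆ B, X = sInf C}ᵒᵈ

/-- The property `Q` holds for sufficiently generic `m`-tuples of points of `V`: there is a nonzero
polynomial in the coordinates of the `m` points such that `Q` holds for all tuples at which it does
not vanish. (This does not depend on the basis that defines the coordinates.) -/
def ForGenericPoints [FiniteDimensional ℝ V] (m : ℕ) (Q : (Fin m → V) → Prop) : Prop :=
  ∃ P : MvPolynomial (Fin m × Fin (Module.finrank ℝ V)) ℝ, P ≠ 0 ∧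
    ∀ p : Fin m → V,
      MvPolynomial.eval (fun ij => (Module.finBasis ℝ V).repr (p ij.1) ij.2) P ≠ 0 → Q p

end ValidOrder

end


/-!
The pairs `(α, c)` in `V* × ℝ` for which the affine function `α + c` vanishes at `p₁, …, p_m` form
a subspace `X`, of codimension `m` for generic points. For each `S ⊆ A` with `m + 1` elements,
`X` meets the span of the vectors `v_H`, `H ∈ S`, in a subspace of dimension at most `1`, say in
`ℝ y_S`. As Lovász observed, for `X` in general position the vectors `y_S` represent the Dilworth
truncation `D_m M_A`. On the other hand, the hyperplanes of `vo(A; p₁, …, p_m)` are exactly the zero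
sets of the nonzero `y_S`. All of them contain `p₁`, and the intersection lattice of such a central
arrangement is the lattice of flats of the linear matroid of its equations.

General position amounts to the non-vanishing of determinants that are polynomials in the
coordinates of the points, so for each of its finitely many conditions it is enough to find one
tuple of points that satisfies it. For the linear independence of the `y_S`, where `S` runs over an
independent set of `D_m M_A`, a theorem of Rado's type yields linearly independent vectors `w_S` in
the spans `U_S` such that `U_S` meets the span of all the `w_T` only in `ℝ w_S`, and the points are
chosen such that the functionals vanishing at them meet each `U_S` inside the span of the `w_T`.
-/

namespace ValidOrder

open Module

/-! ### Rank, closure and flats of linear matroids -/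

section LinearMatroid

variable {K W ι : Type*} [Field K] [AddCommGroup W] [Module K W] {v : ι → W} {E F I X : Set ι}

@[simp]
theorem linearMatroid_ground : (linearMatroid (K := K) v E).E = E := rfl

theorem linearMatroid_indep :
    (linearMatroid (K := K) v E).Indep I ↔ I ⊆ E ∧ LinearIndepOn K v I := by
  simp [linearMatroid]

theorem span_image_eq_of_isBasis (h : (linearMatroid (K := K) v E).IsBasis I X) :
    Submodule.span K (v '' I) = Submodule.span K (v '' X) := by
  refine le_antisymm (Submodule.span_mono (Set.image_mono h.subset)) (Submodule.span_le.2 ?_)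
  rintro _ ⟨e, he, rfl⟩
  by_contra hv
  have hI := linearMatroid_indep.1 h.indep
  have heI : e ∈ I := h.mem_of_insert_indep he (linearMatroid_indep.2
    ⟨Set.insert_subset (h.subset_ground he) hI.1, hI.2.insert hv⟩)
  exact hv (Submodule.subset_span (Set.mem_image_of_mem v heI))

theorem finrank_span_image_of_linearIndepOn (hI : I.Finite) (h : LinearIndepOn K v I) :
    finrank K (Submodule.span K (v '' I)) = I.ncard := by
  have := hI.fintype
  rw [Set.ncard_eq_toFinset_card', Set.toFinset_card, ← finrank_span_eq_card h,
    Set.image_eq_range]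

theorem eRk_linearMatroid (hX : X.Finite) (hXE : X ⊆ E) :
    (linearMatroid (K := K) v E).eRk X = finrank K (Submodule.span K (v '' X)) := by
  obtain ⟨I, hI⟩ := (linearMatroid (K := K) v E).exists_isBasis X hXE
  have hfin := hX.subset hI.subset
  rw [← hI.encard_eq_eRk, ← span_image_eq_of_isBasis hI,
    finrank_span_image_of_linearIndepOn hfin (linearMatroid_indep.1 hI.indep).2,
    hfin.cast_ncard_eq]

theorem mem_closure_linearMatroid (hF : F ⊆ E) {e : ι} :
    e ∈ (linearMatroid (K := K) v E).closure F ↔ e ∈ E ∧ v e ∈ Submodule.span K (v '' F) := by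
  obtain ⟨I, hI⟩ := (linearMatroid (K := K) v E).exists_isBasis F hF
  obtain ⟨hIE, hli⟩ := linearMatroid_indep.1 hI.indep
  rw [← hI.closure_eq_closure, hI.indep.mem_closure_iff', linearMatroid_ground,
    linearMatroid_indep, linearIndepOn_insert_iff, Set.insert_subset_iff,
    ← span_image_eq_of_isBasis hI]
  have : e ∈ I → v e ∈ Submodule.span K (v '' I) := fun he => Submodule.subset_span ⟨e, he, rfl⟩
  tauto

theorem isFlat_linearMatroid_iff : (linearMatroid (K := K) v E).IsFlat F ↔
    F ⊆ E ∧ ∀ e ∈ E, v e ∈ Submodule.span K (v '' F) → e ∈ F := by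
  constructor
  · intro h
    refine ⟨h.subset_ground, fun e he hv => ?_⟩
    rw [← h.closure]
    exact (mem_closure_linearMatroid h.subset_ground).2 ⟨he, hv⟩
  · rintro ⟨hF, h⟩
    refine Matroid.isFlat_iff_closure_eq.2
      (Set.Subset.antisymm (fun e he => ?_) (Matroid.subset_closure _ F hF))
    obtain ⟨heE, hv⟩ := (mem_closure_linearMatroid hF).1 he
    exact h e heE hv

end LinearMatroid

/-! ### Independent transversals of families of subspaces -/

section Transversal

variable {K W ι κ : Type*} [Field K] [AddCommGroup W] [Module K W]

theorem exists_mem_forall_notMem [Infinite K] [Finite κ] {U : Submodule K W}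
    {P : κ → Submodule K W} (h : ∀ a, ¬ U ≤ P a) : ∃ w ∈ U, ∀ a, w ∉ P a := by
  obtain ⟨w, hw⟩ := Submodule.exists_forall_notMem_of_forall_ne_top
    (fun a => (P a).comap U.subtype) fun a => by
      simpa only [ne_eq, Submodule.comap_subtype_eq_top] using h a
  exact ⟨w, w.2, hw⟩

theorem linearIndepOn_mkQ_comp_iff {Z : Submodule K W} {w : ι → W} {T : Finset ι} :
    LinearIndepOn K (Z.mkQ ∘ w) (T : Set ι) ↔
      ∀ c : ι → K, ∑ i ∈ T, c i • w i ∈ Z → ∀ i ∈ T, c i = 0 := by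
  simp only [linearIndepOn_finset_iff, Function.comp_apply, ← map_smul, ← map_sum,
    ← LinearMap.mem_ker, Submodule.ker_mkQ]

theorem linearIndepOn_mkQ_comp_update [DecidableEq ι] {Z : Submodule K W} {w : ι → W}
    {T : Finset ι} {i : ι} {v : W} (hi : i ∈ T) (hv : v ∉ Z)
    (h : LinearIndepOn K ((Z ⊔ K ∙ v).mkQ ∘ w) (T.erase i : Finset ι)) :
    LinearIndepOn K (Z.mkQ ∘ Function.update w i v) (T : Set ι) := by
  rw [linearIndepOn_mkQ_comp_iff] at h
  refine linearIndepOn_mkQ_comp_iff.2 fun c hc => ?_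
  rw [← Finset.add_sum_erase T _ hi, Function.update_self, Finset.sum_congr rfl fun j hj => by
    rw [Function.update_of_ne (Finset.ne_of_mem_erase hj)]] at hc
  have hc' : ∑ j ∈ T.erase i, c j • w j ∈ Z ⊔ K ∙ v := by
    rw [← add_sub_cancel_left (c i • v) (∑ j ∈ T.erase i, c j • w j)]
    exact sub_mem (Submodule.mem_sup_left hc) (Submodule.mem_sup_right
      (Submodule.smul_mem _ _ (Submodule.mem_span_singleton_self _)))
  have hzero := h c hc'
  rw [Finset.sum_eq_zero fun j hj => by rw [hzero j hj, zero_smul], add_zero] at hc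
  intro j hj
  obtain rfl | hji := eq_or_ne j i
  · by_contra hne
    exact hv ((Submodule.smul_mem_iff Z hne).1 hc)
  · exact hzero j (Finset.mem_erase.2 ⟨hji, hj⟩)

/-- Rado's condition for the family of subspaces `U i`, `i ∈ T`, to have a transversal that is
linearly independent modulo the subspace `Z`. -/
def RadoCondition (U : ι → Submodule K W) (Z : Submodule K W) (T : Finset ι) : Prop :=
  ∀ J ⊆ T, finrank K Z + J.card ≤ finrank K ↥(Z ⊔ J.sup U)

variable {U : ι → Submodule K W} {Z : Submodule K W} {T : Finset ι} {i : ι} {v : W}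

theorem RadoCondition.not_le (h : RadoCondition U Z T) (hi : i ∈ T) : ¬ U i ≤ Z := by
  intro hle
  have := h {i} (Finset.singleton_subset_iff.2 hi)
  rw [Finset.sup_singleton, sup_eq_left.2 hle, Finset.card_singleton] at this
  omega

theorem exists_mem_forall_notMem_sup [Infinite K] [Finite κ] (U : ι → Submodule K W)
    (Z : κ → Submodule K W) (i : ι) (s : Finset ι) :
    ∃ v ∈ U i, ∀ a, ∀ J ⊆ s, ¬ U i ≤ Z a ⊔ J.sup U → v ∉ Z a ⊔ J.sup U := by
  obtain ⟨v, hvU, hv⟩ := exists_mem_forall_notMem (U := U i)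
    (P := fun q : {q : κ × s.powerset // ¬ U i ≤ Z q.1 ⊔ q.2.1.sup U} => Z q.1.1 ⊔ q.1.2.1.sup U)
    fun q => q.2
  exact ⟨v, hvU, fun a J hJ hle => hv ⟨(a, ⟨J, Finset.mem_powerset.2 hJ⟩), hle⟩⟩

variable [FiniteDimensional K W]

theorem RadoCondition.sup_span_singleton [DecidableEq ι] (h : RadoCondition U Z T) (hi : i ∈ T)
    (hv : ∀ J ⊆ T, ¬ U i ≤ Z ⊔ J.sup U → v ∉ Z ⊔ J.sup U) :
    RadoCondition U (Z ⊔ K ∙ v) (T.erase i) := by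
  intro J hJ
  have hJT : J ⊆ T := hJ.trans (Finset.erase_subset i T)
  have hZv : finrank K ↥(Z ⊔ K ∙ v) ≤ finrank K Z + 1 :=
    (Submodule.finrank_add_le_finrank_add_finrank Z (K ∙ v)).trans
      (Nat.add_le_add_left ((finrank_span_le_card {v}).trans_eq (by simp)) _)
  suffices finrank K Z + 1 + J.card ≤ finrank K ↥(Z ⊔ J.sup U ⊔ K ∙ v) by
    rw [sup_right_comm]
    omega
  by_cases hle : U i ≤ Z ⊔ J.sup U
  · have hins := h (insert i J) (Finset.insert_subset hi hJT)
    rw [Finset.sup_insert, sup_left_comm, sup_eq_right.2 hle,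
      Finset.card_insert_of_notMem fun hiJ => Finset.notMem_erase i T (hJ hiJ)] at hins
    have := Submodule.finrank_mono (le_sup_left : Z ⊔ J.sup U ≤ Z ⊔ J.sup U ⊔ K ∙ v)
    omega
  · have hlt : Z ⊔ J.sup U < Z ⊔ J.sup U ⊔ K ∙ v := left_lt_sup.2 fun hvle =>
      hv J hJT hle ((Submodule.span_singleton_le_iff_mem _ _).1 hvle)
    have := Submodule.finrank_lt_finrank_of_lt hlt
    have := h J hJT
    omega

/-- Rado's theorem for finitely many quotients at once. The vectors are chosen one at a time, each
outside all the subspaces `Z a ⊔ J.sup U` that do not force it, which preserves all Rado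
conditions. -/
theorem exists_transversal_linearIndepOn_mkQ [Infinite K] [Finite κ] {s : Finset ι}
    {Z : κ → Submodule K W} {T : κ → Finset ι} (hT : ∀ a, T a ⊆ s)
    (h : ∀ a, RadoCondition U (Z a) (T a)) :
    ∃ w : ι → W, (∀ i, w i ∈ U i) ∧ ∀ a, LinearIndepOn K ((Z a).mkQ ∘ w) (T a : Set ι) := by
  classical
  induction s using Finset.induction_on generalizing Z T with
  | empty =>
    refine ⟨0, fun i => zero_mem _, fun a => ?_⟩
    rw [Finset.subset_empty.1 (hT a), Finset.coe_empty]
    exact linearIndepOn_empty K _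
  | insert i s his ih =>
    obtain ⟨v, hvU, hv⟩ := exists_mem_forall_notMem_sup U Z i (insert i s)
    obtain ⟨w, hwU, hw⟩ := ih (Z := fun a => if i ∈ T a then Z a ⊔ K ∙ v else Z a)
      (T := fun a => (T a).erase i) (fun a => Finset.subset_insert_iff.1 (hT a)) fun a => by
        split_ifs with hi
        · exact (h a).sup_span_singleton hi fun J hJ => hv a J (hJ.trans (hT a))
        · simpa only [Finset.erase_eq_of_notMem hi] using h a
    refine ⟨Function.update w i v, fun j => ?_, fun a => ?_⟩
    · obtain rfl | hj := eq_or_ne j i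
      · rwa [Function.update_self]
      · rw [Function.update_of_ne hj]
        exact hwU j
    · have hwa := hw a
      by_cases hi : i ∈ T a
      · rw [if_pos hi] at hwa
        have hvZ : v ∉ Z a ⊔ (∅ : Finset ι).sup U := hv a ∅ (Finset.empty_subset _) (by
          simpa only [Finset.sup_empty, sup_bot_eq] using (h a).not_le hi)
        rw [Finset.sup_empty, sup_bot_eq] at hvZ
        exact linearIndepOn_mkQ_comp_update hi hvZ hwa
      · rw [if_neg hi, Finset.erase_eq_of_notMem hi] at hwa
        refine hwa.congr fun j hj => ?_
        rw [Function.comp_apply, Function.comp_apply,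
          Function.update_of_ne (ne_of_mem_of_not_mem (Finset.mem_coe.1 hj) hi)]

theorem radoCondition_span_singleton {m : ℕ} (hm : 1 ≤ m)
    (hJ : ∀ J : Finset ι, J.Nonempty → J.card + m ≤ finrank K ↥(J.sup U)) {e : W} (he : e ≠ 0)
    (T : Finset ι) : RadoCondition U (K ∙ e) T := by
  intro J _
  obtain rfl | hne := J.eq_empty_or_nonempty
  · rw [Finset.sup_empty, sup_bot_eq, Finset.card_empty, add_zero]
  · rw [finrank_span_singleton he]
    have := hJ J hne
    have := Submodule.finrank_mono (le_sup_right : J.sup U ≤ K ∙ e ⊔ J.sup U)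
    omega

omit [FiniteDimensional K W] in
theorem radoCondition_of_finrank_eq {m : ℕ} (hi : finrank K (U i) = m + 1)
    (hJ : ∀ J : Finset ι, J.Nonempty → J.card + m ≤ finrank K ↥(J.sup U)) (hiT : i ∉ T) :
    RadoCondition U (U i) T := by
  classical
  intro J hJT
  have := hJ (insert i J) (Finset.insert_nonempty i J)
  rw [Finset.card_insert_of_notMem fun hiJ => hiT (hJT hiJ), Finset.sup_insert] at this
  omega

theorem exists_linearIndependent_inf_span_le [Infinite K] [Finite ι] {m : ℕ} (hm : 1 ≤ m)
    (hU : ∀ i, finrank K (U i) = m + 1)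
    (hJ : ∀ J : Finset ι, J.Nonempty → J.card + m ≤ finrank K ↥(J.sup U)) {e : W} (he : e ≠ 0) :
    ∃ w : ι → W, LinearIndependent K w ∧ (∀ i, w i ∈ U i) ∧
      e ∉ Submodule.span K (Set.range w) ∧ ∀ i, U i ⊓ Submodule.span K (Set.range w) ≤ K ∙ w i := by
  classical
  have := Fintype.ofFinite ι
  obtain ⟨w, hwU, hw⟩ := exists_transversal_linearIndepOn_mkQ (U := U) (κ := Option ι)
    (Z := fun a => a.elim (K ∙ e) U) (T := fun a => a.elim Finset.univ Finset.univ.erase)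
    (fun _ => Finset.subset_univ _) (by
      rintro (_ | i)
      exacts [radoCondition_span_singleton hm hJ he _,
        radoCondition_of_finrank_eq (hU i) hJ (Finset.notMem_erase i _)])
  have hwe := linearIndepOn_mkQ_comp_iff.1 (hw none)
  have hwi := fun i => linearIndepOn_mkQ_comp_iff.1 (hw (some i))
  simp only [Option.elim_none, Option.elim_some, Finset.mem_univ, true_imp_iff] at hwe hwi
  refine ⟨w, Fintype.linearIndependent_iff.2 fun c hc => hwe c (hc ▸ zero_mem _), hwU, ?_, ?_⟩
  · intro hmem
    obtain ⟨c, rfl⟩ := (Submodule.mem_span_range_iff_exists_fun K).1 hmem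
    have hc := hwe c (Submodule.mem_span_singleton_self _)
    exact he (Finset.sum_eq_zero fun i _ => by rw [hc i, zero_smul])
  · rintro i _ ⟨hxU, hx⟩
    obtain ⟨c, rfl⟩ := (Submodule.mem_span_range_iff_exists_fun K).1 hx
    rw [SetLike.mem_coe, ← Finset.add_sum_erase _ _ (Finset.mem_univ i)] at hxU
    have hc := hwi i c ((Submodule.add_mem_iff_right _ (Submodule.smul_mem _ _ (hwU i))).1 hxU)
    rw [← Finset.add_sum_erase _ _ (Finset.mem_univ i),
      Finset.sum_eq_zero fun j hj => by rw [hc j hj, zero_smul], add_zero]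
    exact Submodule.smul_mem _ _ (Submodule.mem_span_singleton_self _)

end Transversal

section Separation

variable {K W κ : Type*} [Field K] [Infinite K] [AddCommGroup W] [Module K W]
  [FiniteDimensional K W] [Finite κ]

theorem exists_dual_disjoint {m : ℕ} {U : κ → Submodule K W} (hU : ∀ i, finrank K (U i) ≤ m)
    {e : W} (he : e ≠ 0) : ∃ f : Fin m → Dual K W, (∀ k, f k e ≠ 0) ∧
      ∀ i, Disjoint (U i) (⨅ k, LinearMap.ker (f k)) := by
  induction m generalizing U with
  | zero =>
    refine ⟨Fin.elim0, fun k => k.elim0, fun i => ?_⟩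
    rw [Submodule.finrank_eq_zero.1 (Nat.le_zero.1 (hU i))]
    exact disjoint_bot_left
  | succ m ih =>
    have hne : ∀ i, ∃ u : W, u ≠ 0 ∧ (U i ≠ ⊥ → u ∈ U i) := fun i => by
      by_cases h : U i = ⊥
      · exact ⟨e, he, fun h' => absurd h h'⟩
      · obtain ⟨u, hu, hu0⟩ := Submodule.exists_mem_ne_zero_of_ne_bot h
        exact ⟨u, hu0, fun _ => hu⟩
    choose u hu0 hu using hne
    obtain ⟨g, hg⟩ := Module.exists_dual_forall_apply_ne_zero (K := K)
      (fun a : Option κ => a.elim e u) (by rintro (_ | i); exacts [he, hu0 i])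
    have hker : ∀ i, finrank K ↥(U i ⊓ LinearMap.ker g) ≤ m := fun i => by
      by_cases h : U i = ⊥
      · rw [h, bot_inf_eq, finrank_bot]
        exact Nat.zero_le m
      · have hlt : U i ⊓ LinearMap.ker g < U i :=
          inf_lt_left.2 fun hle => hg (some i) (hle (hu i h))
        have := Submodule.finrank_lt_finrank_of_lt hlt
        have := hU i
        omega
    obtain ⟨f, hfe, hf⟩ := ih hker
    refine ⟨Fin.cons g f, Fin.cases (hg none) hfe, fun i => ?_⟩
    have hinf : ⨅ k, LinearMap.ker ((Fin.cons g f : Fin (m + 1) → Dual K W) k) =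
        LinearMap.ker g ⊓ ⨅ k, LinearMap.ker (f k) := by
      ext x
      simp [Fin.forall_fin_succ]
    rw [hinf, disjoint_iff, ← inf_assoc, ← disjoint_iff]
    exact hf i

theorem exists_dual_inf_iInf_ker_le {m : ℕ} {U : κ → Submodule K W} {X : Submodule K W}
    (hU : ∀ i, finrank K (U i) ≤ finrank K ↥(U i ⊓ X) + m) {e : W} (he : e ∉ X) :
    ∃ f : Fin m → Dual K W, (∀ k, f k e ≠ 0) ∧ ∀ i, U i ⊓ ⨅ k, LinearMap.ker (f k) ≤ X := by
  have hmap : ∀ i, finrank K ((U i).map X.mkQ) ≤ m := fun i => by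
    have h := LinearMap.finrank_range_add_finrank_ker (X.mkQ.domRestrict (U i))
    rw [LinearMap.range_domRestrict, LinearMap.ker_domRestrict, Submodule.ker_mkQ,
      ← Submodule.finrank_map_subtype_eq (U i), Submodule.map_comap_subtype] at h
    have := hU i
    omega
  obtain ⟨f, hfe, hf⟩ := exists_dual_disjoint hmap (e := X.mkQ e) fun h => he (by simpa using h)
  refine ⟨fun k => f k ∘ₗ X.mkQ, hfe, fun i x hx => ?_⟩
  have hx0 := Submodule.disjoint_def.1 (hf i) (X.mkQ x) (Submodule.mem_map_of_mem hx.1)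
    (by simpa using hx.2)
  simpa using hx0

end Separation

/-! ### Dimensions and independence of intersections with a subspace -/

section Intersections

variable {K W ι : Type*} [Field K] [AddCommGroup W] [Module K W] [Fintype ι]

theorem finrank_le_finrank_inf_iInf_ker_add_card [FiniteDimensional K W] (U : Submodule K W)
    (f : ι → Dual K W) :
    finrank K U ≤ finrank K ↥(U ⊓ ⨅ i, LinearMap.ker (f i)) + Fintype.card ι := by
  let L : U →ₗ[K] ι → K := LinearMap.pi fun i => f i ∘ₗ U.subtype
  have hker : LinearMap.ker L = (⨅ i, LinearMap.ker (f i)).comap U.subtype := by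
    ext x
    simp [L, funext_iff]
  have h := LinearMap.finrank_range_add_finrank_ker L
  rw [hker, ← Submodule.finrank_map_subtype_eq U, Submodule.map_comap_subtype] at h
  have := Submodule.finrank_le (LinearMap.range L)
  rw [finrank_fintype_fun_eq_card] at this
  omega

theorem exists_le_finrank_eq [FiniteDimensional K W] {U : Submodule K W} {n : ℕ}
    (h : n ≤ finrank K U) : ∃ U' ≤ U, finrank K U' = n := by
  obtain ⟨b, hb⟩ := exists_linearIndependent_of_le_finrank h
  refine ⟨(Submodule.span K (Set.range b)).map U.subtype, Submodule.map_subtype_le _ _, ?_⟩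
  rw [Submodule.finrank_map_subtype_eq, finrank_span_eq_card hb, Fintype.card_fin]

theorem iSupIndep_inf_iff {U : ι → Submodule K W} {X : Submodule K W} :
    iSupIndep (fun i => U i ⊓ X) ↔
      Disjoint (Submodule.pi Set.univ U ⊓ LinearMap.ker (∑ i, LinearMap.proj (R := K) i))
        (Submodule.pi Set.univ fun _ => X) := by
  classical
  rw [iSupIndep_iff_finsetSum_eq_zero_imp_eq_zero, Submodule.disjoint_def]
  simp only [Submodule.mem_inf, Submodule.mem_pi, Set.mem_univ, true_imp_iff, LinearMap.mem_ker,
    LinearMap.sum_apply, LinearMap.proj_apply]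
  refine ⟨fun h x hx hxX => ?_, fun h s x hx hsum i hi => ?_⟩
  · exact funext fun i => h Finset.univ x (fun i _ => ⟨hx.1 i, hxX i⟩) hx.2 i (Finset.mem_univ i)
  · have := h (fun i => if i ∈ s then x i else 0) ⟨fun i => ?_, by simpa using hsum⟩ fun i => ?_
    · simpa [hi] using congrFun this i
    all_goals split_ifs with hi
    exacts [(hx i hi).1, zero_mem _, (hx i hi).2, zero_mem _]

end Intersections

/-! ### Generic points -/

section Generic

theorem det_mem {n R S : Type*} [Fintype n] [DecidableEq n] [CommRing R] [SetLike S R]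
    [SubringClass S R] {s : S} {M : Matrix n n R} (hM : ∀ i j, M i j ∈ s) : M.det ∈ s := by
  rw [Matrix.det_apply]
  exact sum_mem fun σ _ => zsmul_mem (prod_mem fun i _ => hM (σ i) i) _

variable {V : Type*} [AddCommGroup V] [Module ℝ V] [FiniteDimensional ℝ V] {m : ℕ}

theorem ForGenericPoints.mono {Q R : (Fin m → V) → Prop} (hQ : ForGenericPoints m Q)
    (h : ∀ p, Q p → R p) : ForGenericPoints m R := by
  obtain ⟨P, hP, hPQ⟩ := hQ
  exact ⟨P, hP, fun p hp => h p (hPQ p hp)⟩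

theorem ForGenericPoints.of_forall {Q : (Fin m → V) → Prop} (h : ∀ p, Q p) :
    ForGenericPoints m Q :=
  ⟨1, one_ne_zero, fun p _ => h p⟩

theorem ForGenericPoints.and {Q R : (Fin m → V) → Prop} (hQ : ForGenericPoints m Q)
    (hR : ForGenericPoints m R) : ForGenericPoints m fun p => Q p ∧ R p := by
  obtain ⟨P, hP, hPQ⟩ := hQ
  obtain ⟨P', hP', hPR⟩ := hR
  refine ⟨P * P', mul_ne_zero hP hP', fun p hp => ?_⟩
  rw [map_mul] at hp
  exact ⟨hPQ p (left_ne_zero_of_mul hp), hPR p (right_ne_zero_of_mul hp)⟩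

theorem ForGenericPoints.forall_mem {ι : Type*} (s : Finset ι) {Q : ι → (Fin m → V) → Prop}
    (h : ∀ i ∈ s, ForGenericPoints m (Q i)) : ForGenericPoints m fun p => ∀ i ∈ s, Q i p := by
  classical
  induction s using Finset.induction_on with
  | empty => exact .of_forall fun p i hi => absurd hi (Finset.notMem_empty i)
  | insert i s _ ih =>
    refine ((h i (Finset.mem_insert_self i s)).and
      (ih fun j hj => h j (Finset.mem_insert_of_mem hj))).mono fun p hp => ?_
    simpa only [Finset.forall_mem_insert] using hp

variable (V m) in
/-- The algebra of polynomial functions of `m` points of `V`, that is, of polynomials in the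
coordinates that occur in `ForGenericPoints`. -/
noncomputable def polynomialFunctions : Subalgebra ℝ ((Fin m → V) → ℝ) :=
  (AlgHom.pi fun p : Fin m → V => MvPolynomial.aeval
    fun ij : Fin m × Fin (finrank ℝ V) => (finBasis ℝ V).repr (p ij.1) ij.2).range

theorem mem_polynomialFunctions {g : (Fin m → V) → ℝ} : g ∈ polynomialFunctions V m ↔
    ∃ P : MvPolynomial (Fin m × Fin (finrank ℝ V)) ℝ, ∀ p : Fin m → V,
      MvPolynomial.eval (fun ij => (finBasis ℝ V).repr (p ij.1) ij.2) P = g p := by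
  simp only [polynomialFunctions, AlgHom.mem_range, funext_iff, AlgHom.pi_apply,
    MvPolynomial.aeval_eq_eval]

theorem dual_apply_mem_polynomialFunctions (β : Dual ℝ V) (k : Fin m) :
    (fun p => β (p k)) ∈ polynomialFunctions V m := by
  refine mem_polynomialFunctions.2
    ⟨∑ j, MvPolynomial.C (β (finBasis ℝ V j)) * MvPolynomial.X (k, j), fun p => ?_⟩
  conv_rhs => rw [← (finBasis ℝ V).sum_repr (p k)]
  simp only [map_sum, map_smul, smul_eq_mul, map_mul, MvPolynomial.eval_C, MvPolynomial.eval_X,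
    mul_comm]

theorem forGenericPoints_ne_zero {g : (Fin m → V) → ℝ} (hg : g ∈ polynomialFunctions V m)
    {p₀ : Fin m → V} (h₀ : g p₀ ≠ 0) : ForGenericPoints m fun p => g p ≠ 0 := by
  obtain ⟨P, hP⟩ := mem_polynomialFunctions.1 hg
  refine ⟨P, fun h => h₀ ?_, fun p hp => by rwa [hP] at hp⟩
  rw [← hP, h, map_zero]

theorem dual_comp_mem_polynomialFunctions {κ : Type*} [Finite κ] {G : (Fin m → V) → κ → ℝ}
    (hG : ∀ a, (fun p => G p a) ∈ polynomialFunctions V m) (f : Dual ℝ (κ → ℝ)) :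
    (fun p => f (G p)) ∈ polynomialFunctions V m := by
  classical
  have := Fintype.ofFinite κ
  have hsum : (fun p => f (G p)) = ∑ a, f (Pi.single a 1) • fun p => G p a := by
    funext p
    rw [f.pi_apply_eq_sum_univ (G p)]
    simp [Finset.sum_apply, mul_comm, ← Pi.single_apply, Pi.single_comm]
  rw [hsum]
  exact sum_mem fun a _ => Subalgebra.smul_mem _ (hG a) _

theorem forGenericPoints_ker_eq_bot {E κ : Type*} [AddCommGroup E] [Module ℝ E]
    [FiniteDimensional ℝ E] [Finite κ] {F : (Fin m → V) → E →ₗ[ℝ] κ → ℝ}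
    (hF : ∀ x a, (fun p => F p x a) ∈ polynomialFunctions V m) {p₀ : Fin m → V}
    (h₀ : LinearMap.ker (F p₀) = ⊥) : ForGenericPoints m fun p => LinearMap.ker (F p) = ⊥ := by
  obtain ⟨N, hN⟩ := LinearMap.exists_leftInverse_of_injective (F p₀) h₀
  let b := finBasis ℝ E
  let M : Matrix (Fin (finrank ℝ E)) (Fin (finrank ℝ E)) ((Fin m → V) → ℝ) :=
    fun i j p => b.coord i (N (F p (b j)))
  have hM : M.det ∈ polynomialFunctions V m := det_mem fun i j =>
    dual_comp_mem_polynomialFunctions (hF (b j)) (b.coord i ∘ₗ N)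
  have hdet : ∀ p, M.det p = LinearMap.det (N ∘ₗ F p) := fun p => by
    rw [← LinearMap.det_toMatrix b]
    refine (RingHom.map_det (Pi.evalRingHom (fun _ => ℝ) p) M).trans (congrArg _ ?_)
    ext i j
    rw [LinearMap.toMatrix_apply]
    rfl
  refine (forGenericPoints_ne_zero hM (p₀ := p₀) ?_).mono fun p hp => ?_
  · rw [hdet, hN, LinearMap.det_id]
    exact one_ne_zero
  · rw [hdet, ← isUnit_iff_ne_zero, ← LinearMap.isUnit_iff_isUnit_det,
      LinearMap.isUnit_iff_ker_eq_bot, ← le_bot_iff] at hp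
    exact le_bot_iff.1 ((LinearMap.ker_le_ker_comp (F p) N).trans hp)

end Generic

/-! ### Functionals vanishing at generic points -/

section Functionals

variable {V : Type*} [AddCommGroup V] [Module ℝ V] {m : ℕ}

/-- The linear form `(x, t) ↦ α x + c t` on `V × ℝ` given by the pair `(α, c)`. Thus the normal
vector of a hyperplane is sent to an equation of its semicone, and the values at `(x, 1)` are those
of the affine function `α + c`. -/
def linearForm : Dual ℝ V × ℝ →ₗ[ℝ] Dual ℝ (V × ℝ) where
  toFun φ := φ.1.coprod (φ.2 • LinearMap.id)
  map_add' φ ψ := by ext <;> simp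
  map_smul' c φ := by ext <;> simp

@[simp]
theorem linearForm_apply (φ : Dual ℝ V × ℝ) (z : V × ℝ) :
    linearForm φ z = φ.1 z.1 + φ.2 * z.2 := rfl

/-- The space of all `(α, c)` such that the affine function `α + c` vanishes at the points `p k`. -/
def vanishing (p : Fin m → V) : Submodule ℝ (Dual ℝ V × ℝ) :=
  ⨅ k, LinearMap.ker (linearForm.flip (p k, 1))

theorem mem_vanishing {p : Fin m → V} {φ : Dual ℝ V × ℝ} :
    φ ∈ vanishing p ↔ ∀ k, φ.1 (p k) + φ.2 = 0 := by
  simp [vanishing]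

variable [FiniteDimensional ℝ V]

theorem exists_ker_linearForm_flip_eq {f : Dual ℝ (Dual ℝ V × ℝ)} (hf : f (0, 1) ≠ 0) :
    ∃ q : V, LinearMap.ker (linearForm.flip (q, 1)) = LinearMap.ker f := by
  refine ⟨(evalEquiv ℝ V).symm ((f (0, 1))⁻¹ • f ∘ₗ LinearMap.inl ℝ (Dual ℝ V) ℝ), ?_⟩
  ext φ
  have hφ : f φ = f (φ.1, 0) + φ.2 * f (0, 1) := by
    rw [← smul_eq_mul, ← map_smul, ← map_add]
    simp
  rw [LinearMap.mem_ker, LinearMap.mem_ker, hφ, LinearMap.flip_apply, linearForm_apply,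
    apply_evalEquiv_symm_apply]
  simp only [LinearMap.smul_apply, LinearMap.comp_apply, LinearMap.inl_apply, smul_eq_mul]
  field_simp
  rw [mul_zero]

theorem exists_inf_vanishing_le {κ : Type*} [Finite κ] {U : κ → Submodule ℝ (Dual ℝ V × ℝ)}
    {X : Submodule ℝ (Dual ℝ V × ℝ)} (hX : (0, 1) ∉ X)
    (hU : ∀ i, finrank ℝ (U i) ≤ finrank ℝ ↥(U i ⊓ X) + m) :
    ∃ p : Fin m → V, ∀ i, U i ⊓ vanishing p ≤ X := by
  obtain ⟨f, hfe, hf⟩ := exists_dual_inf_iInf_ker_le hU hX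
  choose p hp using fun k => exists_ker_linearForm_flip_eq (hfe k)
  exact ⟨p, fun i => by simpa only [vanishing, hp] using hf i⟩

theorem forGenericPoints_disjoint_pi_vanishing {κ : Type*} [Finite κ]
    {R : Submodule ℝ (κ → Dual ℝ V × ℝ)} {p₀ : Fin m → V}
    (h₀ : Disjoint R (Submodule.pi Set.univ fun _ => vanishing p₀)) :
    ForGenericPoints m fun p : Fin m → V =>
      Disjoint R (Submodule.pi Set.univ fun _ => vanishing p) := by
  let F (p : Fin m → V) : R →ₗ[ℝ] κ × Fin m → ℝ := LinearMap.pi fun a =>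
    linearForm.flip (p a.2, 1) ∘ₗ LinearMap.proj a.1 ∘ₗ R.subtype
  have hF : ∀ p, LinearMap.ker (F p) = ⊥ ↔
      Disjoint R (Submodule.pi Set.univ fun _ => vanishing p) := fun p => by
    have hker : LinearMap.ker (F p) =
        (Submodule.pi Set.univ fun _ => vanishing p).comap R.subtype := by
      ext x
      simp [F, mem_vanishing, funext_iff]
    rw [hker, Submodule.disjoint_iff_comap_eq_bot]
  have hpoly : ∀ x a, (fun p => F p x a) ∈ polynomialFunctions V m := fun x a => by
    have hx : (fun p => F p x a) =
        (fun p => (x.1 a.1).1 (p a.2)) + algebraMap ℝ _ (x.1 a.1).2 := by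
      funext p
      simp [F]
    rw [hx]
    exact add_mem (dual_apply_mem_polynomialFunctions _ _) (Subalgebra.algebraMap_mem _ _)
  have hgen : ForGenericPoints m fun p => LinearMap.ker (F p) = ⊥ :=
    forGenericPoints_ker_eq_bot (E := R) hpoly ((hF p₀).2 h₀)
  exact hgen.mono fun p => (hF p).1

theorem forGenericPoints_disjoint_vanishing {U : Submodule ℝ (Dual ℝ V × ℝ)}
    (hU : finrank ℝ U ≤ m) : ForGenericPoints m fun p : Fin m → V => Disjoint U (vanishing p) := by
  have hpi : ∀ X : Submodule ℝ (Dual ℝ V × ℝ), Disjoint (Submodule.pi Set.univ fun _ : Unit => U)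
      (Submodule.pi Set.univ fun _ => X) ↔ Disjoint U X := fun X => by
    simp only [Submodule.disjoint_def, Submodule.mem_pi, Set.mem_univ, forall_const,
      funext_iff, Pi.zero_apply]
    exact ⟨fun h x hU hX => h (fun _ => x) (fun _ => hU) (fun _ => hX) (),
      fun h x hU hX _ => h (x ()) (hU ()) (hX ())⟩
  obtain ⟨p, hp⟩ := exists_inf_vanishing_le (U := fun _ : Unit => U) (X := ⊥) (m := m)
    (fun h => one_ne_zero (Prod.ext_iff.1 h).2) fun _ => hU.trans (Nat.le_add_left m _)
  exact (forGenericPoints_disjoint_pi_vanishing ((hpi _).2 (disjoint_iff_inf_le.2 (hp ())))).mono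
    fun p hp => (hpi _).1 hp

theorem forGenericPoints_finrank_inf_vanishing (U : Submodule ℝ (Dual ℝ V × ℝ)) :
    ForGenericPoints m fun p : Fin m → V => finrank ℝ ↥(U ⊓ vanishing p) = finrank ℝ U - m := by
  obtain ⟨U', hU', hcard⟩ := exists_le_finrank_eq (min_le_left (finrank ℝ U) m)
  refine (forGenericPoints_disjoint_vanishing (hcard.trans_le (min_le_right _ _))).mono
    fun p hp => ?_
  have hcodim := finrank_le_finrank_inf_iInf_ker_add_card U fun k => linearForm.flip (p k, 1)
  have hdisj : Disjoint U' (U ⊓ vanishing p) := hp.mono_right inf_le_right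
  have hle := Submodule.finrank_mono (sup_le hU' inf_le_left : U' ⊔ U ⊓ vanishing p ≤ U)
  rw [Fintype.card_fin] at hcodim
  change _ ≤ finrank ℝ ↥(U ⊓ vanishing p) + m at hcodim
  have := Submodule.finrank_sup_add_finrank_inf_eq U' (U ⊓ vanishing p)
  rw [hdisj.eq_bot, finrank_bot] at this
  omega

theorem forGenericPoints_iSupIndep_inf_vanishing {ι : Type*} [Finite ι] (hm : 1 ≤ m)
    {U : ι → Submodule ℝ (Dual ℝ V × ℝ)} (hU : ∀ i, finrank ℝ (U i) = m + 1)
    (hJ : ∀ J : Finset ι, J.Nonempty → J.card + m ≤ finrank ℝ ↥(J.sup U)) :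
    ForGenericPoints m fun p : Fin m → V => iSupIndep fun i => U i ⊓ vanishing p := by
  obtain ⟨w, hw, hwU, he, hle⟩ := exists_linearIndependent_inf_span_le hm hU hJ
    (e := (0, 1)) fun h => one_ne_zero (Prod.ext_iff.1 h).2
  have hdim : ∀ i, finrank ℝ (U i) ≤
      finrank ℝ ↥(U i ⊓ Submodule.span ℝ (Set.range w)) + m := fun i => by
    have hwi : ℝ ∙ w i ≤ U i ⊓ Submodule.span ℝ (Set.range w) :=
      (Submodule.span_singleton_le_iff_mem _ _).2 ⟨hwU i, Submodule.subset_span ⟨i, rfl⟩⟩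
    have := Submodule.finrank_mono hwi
    rw [finrank_span_singleton (hw.ne_zero i)] at this
    have := hU i
    omega
  obtain ⟨p, hp⟩ := exists_inf_vanishing_le he hdim
  have := Fintype.ofFinite ι
  have hindep : iSupIndep fun i => U i ⊓ vanishing p :=
    hw.iSupIndep_span_singleton.mono fun i => (le_inf inf_le_left (hp i)).trans (hle i)
  simp only [iSupIndep_inf_iff] at hindep ⊢
  exact forGenericPoints_disjoint_pi_vanishing hindep

end Functionals

/-! ### Dilworth truncations of linear matroids -/

section DilworthTruncation

theorem dilworthTruncation_indep {α : Type*} {k : ℕ} {M : Matroid α} {I : Set (Finset α)} :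
    (dilworthTruncation k M).Indep I ↔
      I ⊆ {s : Finset α | (s : Set α) ⊆ M.E ∧ s.card = k + 1} ∧ DilworthCondition M k I := by
  simp [dilworthTruncation]

variable {K W ι : Type*} [Field K] [AddCommGroup W] [Module K W] {v : ι → W} {A S T : Finset ι}
  {m : ℕ} {X : Submodule K W}

variable (K v S) in
/-- The span of the vectors `v i`, `i ∈ S`. Its dimension is the rank of `S` in the linear matroid
of `v`. -/
def spanOn : Submodule K W :=
  Submodule.span K (v '' S)

instance : FiniteDimensional K (spanOn K v S) :=
  FiniteDimensional.span_of_finite K (S.finite_toSet.image v)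

theorem spanOn_mono (h : S ⊆ T) : spanOn K v S ≤ spanOn K v T :=
  Submodule.span_mono (Set.image_mono (Finset.coe_subset.2 h))

theorem span_image_biUnion (I : Finset (Finset ι)) :
    Submodule.span K (v '' ⋃ S ∈ I, (S : Set ι)) = I.sup (spanOn K v) := by
  simp only [Set.image_iUnion, Submodule.span_iUnion, Finset.sup_eq_iSup, spanOn]

theorem spanOn_biUnion [DecidableEq ι] (I : Finset (Finset ι)) :
    spanOn K v (I.biUnion id) = I.sup (spanOn K v) := by
  rw [← span_image_biUnion, spanOn, Finset.coe_biUnion]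
  rfl

theorem finrank_spanOn_le_card : finrank K (spanOn K v S) ≤ S.card := by
  classical
  rw [spanOn, ← Finset.coe_image]
  exact (finrank_span_finset_le_card _).trans Finset.card_image_le

theorem dilworthCondition_linearMatroid_iff {I : Set (Finset ι)} (hI : ∀ S ∈ I, S ⊆ A) :
    DilworthCondition (linearMatroid (K := K) v (A : Set ι)) m I ↔
      ∀ J : Finset (Finset ι), (J : Set (Finset ι)) ⊆ I → J.Nonempty →
        J.card + m ≤ finrank K ↥(J.sup (spanOn K v)) := by
  refine forall₂_congr fun J hJ => imp_congr_right fun _ => ?_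
  have hfin : (⋃ S ∈ J, (S : Set ι)).Finite := J.finite_toSet.biUnion fun S _ => S.finite_toSet
  rw [eRk_linearMatroid hfin (Set.iUnion₂_subset fun S hS => Finset.coe_subset.2 (hI S (hJ hS))),
    span_image_biUnion, Nat.cast_le]

theorem finrank_spanOn_of_dilworthCondition {I : Set (Finset ι)}
    (hI : ∀ S ∈ I, S ∈ A.powersetCard (m + 1))
    (h : DilworthCondition (linearMatroid (K := K) v (A : Set ι)) m I) (hS : S ∈ I) :
    finrank K (spanOn K v S) = m + 1 := by
  have hIA : ∀ S ∈ I, S ⊆ A := fun S hS => (Finset.mem_powersetCard.1 (hI S hS)).1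
  refine le_antisymm (finrank_spanOn_le_card.trans (Finset.mem_powersetCard.1 (hI S hS)).2.le) ?_
  have := (dilworthCondition_linearMatroid_iff hIA).1 h {S} (by simpa using hS)
    (Finset.singleton_nonempty S)
  rwa [Finset.sup_singleton, Finset.card_singleton, add_comm] at this

variable (v A m X) in
/-- The subspace `X`, which is to be thought of as having codimension `m`, is in general position
with respect to the vectors `v i`, `i ∈ A`: it meets their spans in the expected dimension
(`0` for spans of dimension less than `m`, by truncated subtraction), and its intersections with
the spans of an independent set of the `m`-th Dilworth truncation are linearly independent. -/
structure InGeneralPosition : Prop where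
  finrank_inf : ∀ S ⊆ A, finrank K ↥(spanOn K v S ⊓ X) = finrank K (spanOn K v S) - m
  iSupIndep_inf : ∀ I ⊆ A.powersetCard (m + 1),
    DilworthCondition (linearMatroid (K := K) v (A : Set ι)) m I →
      iSupIndep fun S : I => spanOn K v S ⊓ X

namespace InGeneralPosition

variable (h : InGeneralPosition v A m X)

include h in
theorem exists_inf_eq_span_singleton (hS : S ∈ A.powersetCard (m + 1)) :
    ∃ y, spanOn K v S ⊓ X = K ∙ y := by
  obtain ⟨hSA, hcard⟩ := Finset.mem_powersetCard.1 hS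
  have hle : finrank K ↥(spanOn K v S ⊓ X) ≤ 1 := by
    have := finrank_spanOn_le_card (K := K) (v := v) (S := S)
    rw [h.finrank_inf S hSA]
    omega
  have := Module.Free.of_divisionRing K ↥(spanOn K v S ⊓ X)
  exact ((Submodule.finrank_le_one_iff_isPrincipal _).1 hle).principal

variable {y : Finset ι → W} (hy : ∀ S ∈ A.powersetCard (m + 1), spanOn K v S ⊓ X = K ∙ y S)
  {I : Finset (Finset ι)} (hI : I ⊆ A.powersetCard (m + 1))

include h hy hI

theorem linearIndepOn_of_dilworthCondition
    (hd : DilworthCondition (linearMatroid (K := K) v (A : Set ι)) m I) :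
    LinearIndepOn K y (I : Set (Finset ι)) := by
  refine (h.iSupIndep_inf I hI hd).linearIndependent _ (fun S => ?_) fun S hS => ?_
  · rw [hy S (hI S.2)]
    exact Submodule.mem_span_singleton_self _
  · have hrank := h.finrank_inf S (Finset.mem_powersetCard.1 (hI S.2)).1
    rw [finrank_spanOn_of_dilworthCondition (fun T hT => hI hT) hd S.2, hy S (hI S.2), hS,
      Submodule.span_zero_singleton, finrank_bot] at hrank
    omega

theorem dilworthCondition_of_linearIndepOn (hli : LinearIndepOn K y (I : Set (Finset ι))) :
    DilworthCondition (linearMatroid (K := K) v (A : Set ι)) m I := by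
  classical
  have hIA : ∀ S ∈ I, S ⊆ A := fun S hS => (Finset.mem_powersetCard.1 (hI hS)).1
  refine (dilworthCondition_linearMatroid_iff hIA).2 fun J hJ hne => ?_
  have hle : Submodule.span K (y '' J) ≤ spanOn K v (J.biUnion id) ⊓ X := by
    refine Submodule.span_le.2 ?_
    rintro _ ⟨S, hS, rfl⟩
    have hyS : y S ∈ spanOn K v S ⊓ X := by
      rw [hy S (hI (hJ hS))]
      exact Submodule.mem_span_singleton_self _
    exact ⟨spanOn_mono (Finset.subset_biUnion_of_mem id hS) hyS.1, hyS.2⟩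
  have hJA : J.biUnion id ⊆ A := Finset.biUnion_subset.2 fun S hS => hIA S (hJ hS)
  have hrank := Submodule.finrank_mono hle
  rw [finrank_span_image_of_linearIndepOn J.finite_toSet (hli.mono hJ), Set.ncard_coe_finset,
    h.finrank_inf _ hJA, spanOn_biUnion] at hrank
  have := hne.card_pos
  omega

omit hI in
theorem dilworthTruncation_eq_linearMatroid :
    dilworthTruncation m (linearMatroid (K := K) v (A : Set ι)) =
      linearMatroid (K := K) y (A.powersetCard (m + 1) : Set (Finset ι)) := by
  have hE : {S : Finset ι | (S : Set ι) ⊆ (A : Set ι) ∧ S.card = m + 1} =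
      (A.powersetCard (m + 1) : Set (Finset ι)) := by
    ext S
    simp
  refine Matroid.ext_indep hE fun I _ => ?_
  rw [dilworthTruncation_indep, linearMatroid_indep, linearMatroid_ground, hE]
  refine and_congr_right fun hI => ?_
  lift I to Finset (Finset ι) using (Finset.finite_toSet _).subset hI
  rw [Finset.coe_subset] at hI
  exact ⟨h.linearIndepOn_of_dilworthCondition hy hI, h.dilworthCondition_of_linearIndepOn hy hI⟩

end InGeneralPosition

theorem forGenericPoints_inGeneralPosition {V : Type*} [AddCommGroup V] [Module ℝ V]
    [FiniteDimensional ℝ V] (hm : 1 ≤ m) (v : ι → Dual ℝ V × ℝ) (A : Finset ι) :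
    ForGenericPoints m fun p : Fin m → V => InGeneralPosition v A m (vanishing p) := by
  classical
  have hrank : ForGenericPoints m fun p : Fin m → V => ∀ S ∈ A.powerset,
      finrank ℝ ↥(spanOn ℝ v S ⊓ vanishing p) = finrank ℝ (spanOn ℝ v S) - m :=
    .forall_mem _ fun S _ => forGenericPoints_finrank_inf_vanishing _
  have hindep : ForGenericPoints m fun p : Fin m → V => ∀ I ∈ (A.powersetCard (m + 1)).powerset,
      DilworthCondition (linearMatroid (K := ℝ) v (A : Set ι)) m I →
        iSupIndep fun S : I => spanOn ℝ v S ⊓ vanishing p := by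
    refine .forall_mem _ fun I hI => ?_
    rw [Finset.mem_powerset] at hI
    by_cases hd : DilworthCondition (linearMatroid (K := ℝ) v (A : Set ι)) m I
    · have hIA : ∀ S ∈ I, S ⊆ A := fun S hS => (Finset.mem_powersetCard.1 (hI hS)).1
      refine (forGenericPoints_iSupIndep_inf_vanishing hm (U := fun S : I => spanOn ℝ v S)
        (fun S => finrank_spanOn_of_dilworthCondition (fun T hT => hI hT) hd S.2)
        fun J hJ => ?_).mono fun p hp _ => hp
      have := (dilworthCondition_linearMatroid_iff hIA).1 hd
        (J.map (Function.Embedding.subtype _))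
        (fun S hS => Finset.property_of_mem_map_subtype J (Finset.mem_coe.1 hS)) (by simpa using hJ)
      rwa [Finset.sup_map, Finset.card_map] at this
    · exact .of_forall fun p h => absurd h hd
  exact (hrank.and hindep).mono fun p hp =>
    ⟨fun S hS => hp.1 S (Finset.mem_powerset.2 hS), fun I hI => hp.2 I (Finset.mem_powerset.2 hI)⟩

end DilworthTruncation

/-! ### Central arrangements -/

section Arrangements

variable {V : Type*} [AddCommGroup V] [Module ℝ V]

theorem linearForm_injective : Function.Injective (linearForm (V := V)) := by
  intro φ ψ h
  refine Prod.ext (LinearMap.ext fun x => ?_) ?_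
  · simpa using LinearMap.congr_fun h (x, 0)
  · simpa using LinearMap.congr_fun h (0, 1)

theorem mem_span_iff_linearForm [FiniteDimensional ℝ V] {s : Set (Dual ℝ V × ℝ)}
    {φ : Dual ℝ V × ℝ} : φ ∈ Submodule.span ℝ s ↔
      ∀ z, (∀ ψ ∈ s, linearForm ψ z = 0) → linearForm φ z = 0 := by
  refine ⟨fun h z hz => ?_, fun h => ?_⟩
  · have hs : s ⊆ LinearMap.ker (linearForm.flip z) := hz
    exact Submodule.span_le.2 hs h
  · have hmem := FiniteDimensional.mem_span_of_iInf_ker_le_ker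
      (L := fun ψ : s => linearForm ψ.1) (K := linearForm φ) fun z hz => h z fun ψ hψ => by
        simp only [Submodule.mem_iInf, LinearMap.mem_ker] at hz
        exact hz ⟨ψ, hψ⟩
    rw [← Set.image_eq_range, ← Submodule.map_span] at hmem
    exact (linearForm_injective.mem_set_image).1 hmem

/-- The zero set in `V` of the affine function `α + c` given by the pair `(α, c)`. -/
def zeroSet (φ : Dual ℝ V × ℝ) : AffineSubspace ℝ V where
  carrier := {x | φ.1 x + φ.2 = 0}
  smul_vsub_vadd_mem' c x y z hx hy hz := by
    simp only [Set.mem_ofPred_eq, vsub_eq_sub, vadd_eq_add, map_add, map_smul, map_sub,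
      smul_eq_mul] at *
    linear_combination c * hx - c * hy + hz

theorem mem_zeroSet {φ : Dual ℝ V × ℝ} {x : V} : x ∈ zeroSet φ ↔ φ.1 x + φ.2 = 0 :=
  Iff.rfl

theorem hasEquation_zeroSet {φ : Dual ℝ V × ℝ} (h : φ.1 ≠ 0) :
    HasEquation (zeroSet φ) φ.1 (-φ.2) :=
  ⟨h, fun _ => by rw [mem_zeroSet, add_eq_zero_iff_eq_neg]⟩

theorem IsHyperplane.zeroSet_normalVec {K : AffineSubspace ℝ V} (h : IsHyperplane K) :
    zeroSet (normalVec K) = K := by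
  ext x
  rw [(hasEquation_normalVec h).2, mem_zeroSet, add_eq_zero_iff_eq_neg]

theorem zeroSet_smul {c : ℝ} (hc : c ≠ 0) (φ : Dual ℝ V × ℝ) : zeroSet (c • φ) = zeroSet φ := by
  ext x
  simp [mem_zeroSet, ← mul_add, hc]

theorem semicone_zeroSet {φ : Dual ℝ V × ℝ} (h : φ.1 ≠ 0) :
    semicone (zeroSet φ) = LinearMap.ker (linearForm φ) := by
  ext ⟨x, t⟩
  rw [mem_semicone_iff (hasEquation_zeroSet h), LinearMap.mem_ker, linearForm_apply, neg_mul,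
    add_eq_zero_iff_eq_neg]

theorem passesThroughInter_zeroSet_iff [FiniteDimensional ℝ V] {φ : Dual ℝ V × ℝ} (h : φ.1 ≠ 0)
    {S : Finset (AffineSubspace ℝ V)} :
    PassesThroughInter (zeroSet φ) S ↔ φ ∈ spanOn ℝ normalVec S := by
  have hsemicone : ∀ H : AffineSubspace ℝ V,
      semicone H = LinearMap.ker (linearForm (normalVec H)) := fun _ => rfl
  rw [spanOn, mem_span_iff_linearForm, PassesThroughInter, semicone_zeroSet h, SetLike.le_def]
  simp only [hsemicone, Submodule.mem_iInf, LinearMap.mem_ker, Set.forall_mem_image,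
    Finset.mem_coe]

theorem fst_ne_zero_of_mem_zeroSet {φ : Dual ℝ V × ℝ} {x : V} (hφ : φ ≠ 0) (hx : x ∈ zeroSet φ) :
    φ.1 ≠ 0 := by
  intro h
  rw [mem_zeroSet, h, LinearMap.zero_apply, zero_add] at hx
  exact hφ (Prod.ext h hx)

/-- The arrangement of the zero sets of the nonzero members of a family of affine functions.
These are hyperplanes as soon as they are nonempty. -/
def zeroArrangement {β : Type*} (y : β → Dual ℝ V × ℝ) (E : Set β) : Set (AffineSubspace ℝ V) :=
  {K | ∃ e ∈ E, y e ≠ 0 ∧ zeroSet (y e) = K}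

theorem mem_vo_iff [FiniteDimensional ℝ V] {A : Finset (AffineSubspace ℝ V)} {m : ℕ} (hm : 1 ≤ m)
    {p : Fin m → V} {K : AffineSubspace ℝ V} :
    K ∈ vo A p ↔ ∃ S ∈ A.powersetCard (m + 1), ∃ φ ∈ spanOn ℝ normalVec S ⊓ vanishing p,
      φ ≠ 0 ∧ zeroSet φ = K := by
  constructor
  · rintro ⟨hK, hpK, S, hSA, hS, hKS⟩
    have h₁ := (hasEquation_normalVec hK).1
    rw [← hK.zeroSet_normalVec] at hpK hKS
    exact ⟨S, Finset.mem_powersetCard.2 ⟨hSA, hS⟩, normalVec K,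
      ⟨(passesThroughInter_zeroSet_iff h₁).1 hKS, mem_vanishing.2 hpK⟩,
      fun h => h₁ (congrArg Prod.fst h), hK.zeroSet_normalVec⟩
  · rintro ⟨S, hS, φ, ⟨hφS, hφp⟩, hφ, rfl⟩
    have hv := mem_vanishing.1 hφp
    have h₁ := fst_ne_zero_of_mem_zeroSet hφ (hv ⟨0, hm⟩)
    obtain ⟨hSA, hcard⟩ := Finset.mem_powersetCard.1 hS
    exact ⟨⟨_, _, hasEquation_zeroSet h₁⟩, hv, S, hSA, hcard,
      (passesThroughInter_zeroSet_iff h₁).2 hφS⟩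

theorem vo_eq_zeroArrangement [FiniteDimensional ℝ V] {A : Finset (AffineSubspace ℝ V)} {m : ℕ}
    (hm : 1 ≤ m) {p : Fin m → V} {y : Finset (AffineSubspace ℝ V) → Dual ℝ V × ℝ}
    (hy : ∀ S ∈ A.powersetCard (m + 1), spanOn ℝ normalVec S ⊓ vanishing p = ℝ ∙ y S) :
    vo A p = zeroArrangement y (A.powersetCard (m + 1)) := by
  ext K
  refine (mem_vo_iff hm).trans (exists_congr fun S => and_congr_right fun hS => ?_)
  rw [hy S hS]
  constructor
  · rintro ⟨φ, hφ, hφ₀, rfl⟩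
    obtain ⟨c, rfl⟩ := Submodule.mem_span_singleton.1 hφ
    obtain ⟨hc, hyS⟩ := smul_ne_zero_iff.1 hφ₀
    exact ⟨hyS, (zeroSet_smul hc _).symm⟩
  · exact fun h => ⟨y S, Submodule.mem_span_singleton_self _, h⟩

end Arrangements

section IntersectionLattice

variable {V β : Type*} [AddCommGroup V] [Module ℝ V] {y : β → Dual ℝ V × ℝ} {E F : Set β}
  {X : AffineSubspace ℝ V} {q x : V}

variable (y E X) in
/-- The indices `e ∈ E` of the affine functions `y e` that vanish on `X`. -/
def vanishingIndices : Set β :=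
  {e ∈ E | X ≤ zeroSet (y e)}

variable (y F) in
/-- The set of common zeros of the affine functions `y e`, `e ∈ F`. -/
def commonZeros : AffineSubspace ℝ V :=
  ⨅ e ∈ F, zeroSet (y e)

theorem mem_commonZeros : x ∈ commonZeros y F ↔ ∀ e ∈ F, x ∈ zeroSet (y e) := by
  simp only [commonZeros, AffineSubspace.mem_iInf_iff]

theorem le_commonZeros_vanishingIndices : X ≤ commonZeros y (vanishingIndices y E X) :=
  le_iInf₂ fun _ he => he.2

theorem commonZeros_eq_sInf : commonZeros y F = sInf (zeroArrangement y F) := by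
  refine le_antisymm (le_sInf ?_) (le_iInf₂ fun e he => ?_)
  · rintro _ ⟨e, he, -, rfl⟩
    exact iInf₂_le e he
  · by_cases h₀ : y e = 0
    · intro x _
      simp [h₀, mem_zeroSet]
    · exact sInf_le ⟨e, he, h₀, rfl⟩

theorem commonZeros_vanishingIndices_sInf {C : Set (AffineSubspace ℝ V)}
    (hC : C ⊆ zeroArrangement y E) : commonZeros y (vanishingIndices y E (sInf C)) = sInf C := by
  refine le_antisymm (le_sInf fun K hK => ?_) le_commonZeros_vanishingIndices
  obtain ⟨e, he, -, rfl⟩ := hC hK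
  exact iInf₂_le e ⟨he, sInf_le hK⟩

theorem commonZeros_mem_intersectionLattice (hq : ∀ e ∈ E, q ∈ zeroSet (y e)) (hF : F ⊆ E) :
    commonZeros y F ≠ ⊥ ∧ ∃ C ⊆ zeroArrangement y E, commonZeros y F = sInf C := by
  refine ⟨fun h => ?_, zeroArrangement y F, ?_, commonZeros_eq_sInf⟩
  · have hmem : q ∈ commonZeros y F := mem_commonZeros.2 fun e he => hq e (hF he)
    rw [h] at hmem
    exact AffineSubspace.notMem_bot ℝ V q hmem
  · rintro _ ⟨e, he, h⟩
    exact ⟨e, hF he, h⟩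

variable [FiniteDimensional ℝ V]

theorem isFlat_vanishingIndices :
    (linearMatroid (K := ℝ) y E).IsFlat (vanishingIndices y E X) := by
  refine isFlat_linearMatroid_iff.2 ⟨fun e he => he.1, fun e he hspan => ⟨he, fun x hx => ?_⟩⟩
  have hz := mem_span_iff_linearForm.1 hspan (x, 1) (by
    rintro _ ⟨f, hf, rfl⟩
    simpa only [linearForm_apply, mul_one] using mem_zeroSet.1 (hf.2 hx))
  simpa only [mem_zeroSet, linearForm_apply, mul_one] using hz

theorem vanishingIndices_commonZeros (hF : (linearMatroid (K := ℝ) y E).IsFlat F)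
    (hq : ∀ e ∈ E, q ∈ zeroSet (y e)) : vanishingIndices y E (commonZeros y F) = F := by
  obtain ⟨hFE, hflat⟩ := isFlat_linearMatroid_iff.1 hF
  refine Set.Subset.antisymm (fun e he => hflat e he.1 (mem_span_iff_linearForm.2 ?_))
    fun e he => ⟨hFE he, iInf₂_le e he⟩
  rintro ⟨x, t⟩ hxt
  -- Adding a multiple of `(q, 1)`, at which all the forms vanish, moves `(x, t)` to height `1`.
  have hshift : ∀ f ∈ E, x + (1 - t) • q ∈ zeroSet (y f) ↔ linearForm (y f) (x, t) = 0 :=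
    fun f hf => by
      have hqf := mem_zeroSet.1 (hq f hf)
      rw [mem_zeroSet, map_add, map_smul, smul_eq_mul, linearForm_apply]
      exact Eq.congr_left (by linear_combination (1 - t) * hqf)
  refine (hshift e he.1).1 (he.2 (mem_commonZeros.2 fun f hf => ?_))
  exact (hshift f (hFE hf)).2 (hxt _ ⟨f, hf, rfl⟩)

/-- The intersections of a central arrangement correspond to the flats of the linear matroid of its
equations: an intersection is sent to the set of the equations that hold on it. -/
noncomputable def intersectionLatticeOrderIso (hq : ∀ e ∈ E, q ∈ zeroSet (y e)) :
    IntersectionLattice (zeroArrangement y E) ≃o LatticeOfFlats (linearMatroid (K := ℝ) y E) where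
  toFun X := ⟨vanishingIndices y E (OrderDual.ofDual X).1, isFlat_vanishingIndices⟩
  invFun F := OrderDual.toDual
    ⟨commonZeros y F.1, commonZeros_mem_intersectionLattice hq F.2.subset_ground⟩
  left_inv := by
    rintro ⟨_, -, C, hC, rfl⟩
    exact congrArg OrderDual.toDual (Subtype.ext (commonZeros_vanishingIndices_sInf hC))
  right_inv F := Subtype.ext (vanishingIndices_commonZeros F.2 hq)
  map_rel_iff' := by
    rintro ⟨_, -, C, hC, rfl⟩ ⟨Y, hY⟩
    refine ⟨fun h => ?_, fun h e he => ⟨he.1, le_trans h he.2⟩⟩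
    change Y ≤ sInf C
    rw [← commonZeros_vanishingIndices_sInf hC]
    exact le_iInf₂ fun e he => (h he).2

end IntersectionLattice

end ValidOrder

theorem mainTheorem11 {V : Type*} [AddCommGroup V] [Module ℝ V] [FiniteDimensional ℝ V]
    (A : Finset (AffineSubspace ℝ V)) (hA : ∀ H ∈ A, ValidOrder.IsHyperplane H)
    (m : ℕ) (hm : 1 ≤ m) :
    ValidOrder.ForGenericPoints (V := V) m fun p =>
      Nonempty (ValidOrder.IntersectionLattice (ValidOrder.vo A p) ≃o
        ValidOrder.LatticeOfFlats
          (ValidOrder.dilworthTruncation m (ValidOrder.arrangementMatroid A))) := by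
  refine (ValidOrder.forGenericPoints_inGeneralPosition hm ValidOrder.normalVec A).mono
    fun p hp => ?_
  choose! y hy using fun S hS => hp.exists_inf_eq_span_singleton (S := S) hS
  rw [ValidOrder.arrangementMatroid, hp.dilworthTruncation_eq_linearMatroid hy,
    ValidOrder.vo_eq_zeroArrangement hm hy]
  refine ⟨ValidOrder.intersectionLatticeOrderIso (q := p ⟨0, hm⟩) fun S hS => ?_⟩
  have hyS := (hy S hS).ge (Submodule.mem_span_singleton_self _)
  exact ValidOrder.mem_vanishing.1 hyS.2 ⟨0, hm⟩
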